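/- A \emph{Seidel matrix} of order $n$ is a real symmetric $n\times n$ matrix $S$ with zero diagonal and all off-diagonal entries equal to $\pm1$; write $\lambda_{\min}(S)$ for its smallest eigenvalue. For a symmetric matrix $M$ with zero diagonal and off-diagonal entries in $\{1,-1\}$, let $G(M)$ be the graph on the index set of $M$ in which two distinct vertices $i,j$ are adjacent if and only if $M_{ij}=-1$. For a Seidel matrix $S$ of order $n\geqslant 2$ put $$S'=\begin{pmatrix} S & -S+\mathbf{I}\\ -S+\mathbf{I} & S\end{pmatrix},$$ and call $\mathcal{S}w(S):=G(S')$ the \emph{switching graph} of $S$. The clique number and the independence number of the switching class $[S]$ of $S$ are defined as $\omega([S]):=\omega(\mathcal{S}w(S))$ and $\alpha([S]):=\alpha(\mathcal{S}w(S))$, the size of a largest clique and of a largest independent set in $\mathcal{S}w(S)$. \textbf{Theorem.} Let $S$ be a Seidel matrix of order $n\geqslant 277$ with $\lambda_{\min}(S)=-5$ and $\omega([S])=4$. If $\alpha([S])\geqslant 39$, then $$\operatorname{rk}(S+5\mathbf{I})\geqslant \frac{2n}{3}+1 .$$ -/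

import Mathlib

/-- A Seidel matrix: a real symmetric matrix with zero diagonal and all off-diagonal entries
equal to `1` or `-1`. -/
def IsSeidelMatrix {V : Type*} (S : Matrix V V ℝ) : Prop :=
  S.IsSymm ∧ (∀ i, S i i = 0) ∧ ∀ i j, i ≠ j → S i j = 1 ∨ S i j = -1

/-- `μ` is the smallest eigenvalue of the real square matrix `M`. -/
def IsSmallestEigenvalue {V : Type*} [Fintype V] [DecidableEq V]
    (M : Matrix V V ℝ) (μ : ℝ) : Prop :=
  IsLeast {t : ℝ | Module.End.HasEigenvalue (Matrix.toLin' M) t} μ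

/-- The graph of a Seidel matrix: distinct vertices `i`, `j` are adjacent if and only if
the `(i, j)` entry is `-1`. (`fromRel` symmetrizes the relation, which changes nothing for a
symmetric matrix.) -/
def seidelGraph {V : Type*} (S : Matrix V V ℝ) : SimpleGraph V :=
  SimpleGraph.fromRel fun i j => S i j = -1

/-- The switching graph of `S`: the graph of the block matrix with rows `(S, -S + I)` and
`(-S + I, S)`. -/
def switchingGraph {V : Type*} [DecidableEq V] (S : Matrix V V ℝ) : SimpleGraph (V ⊕ V) :=
  seidelGraph (Matrix.fromBlocks S (-S + 1) (-S + 1) S)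

/-- The independence number of the switching class of `S`. -/
noncomputable def switchingIndepNum {V : Type*} [DecidableEq V] (S : Matrix V V ℝ) : ℕ :=
  (switchingGraph S).indepNum

/-- The clique number of the switching class of `S`. -/
noncomputable def switchingCliqueNum {V : Type*} [DecidableEq V] (S : Matrix V V ℝ) : ℕ :=
  (switchingGraph S).cliqueNum

open Finset Matrix

set_option linter.unusedSectionVars false

/-! ### The form of 4I − 2A and its nonpositive vectors -/

section GapForm

variable {V : Type*} [Fintype V] [DecidableEq V] (G : SimpleGraph V) [DecidableRel G.Adj]

/-! Write S + 5I = 4I + J − 2A, with A the adjacency matrix of `seidelGraph S` and J the all-ones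
matrix. This matrix is positive semidefinite, and switching preserves both that and the rank, so the
graph may be chosen freely within the switching class.

If 4I − 2A is itself semidefinite, the average degree is at most 2, and comparing its trace with the
trace of its square gives rank at least 2n/3. If it is singular, it kills a nonnegative vector,
which J does not, so adding J gains at least one; if it is definite, the rank is n
(`rank_bound_of_posSemidef`).

Otherwise some vector has negative form. The rank is at least the size of any set U on which 4I − 2A
is positive definite, so it suffices to find U missing at most 91 vertices. Take a set D carrying a
positive vector u of nonpositive form. A second nonnegative vector of nonpositive form living far
from D would be proportional to u modulo the radical (`isotropic_of_orthogonal`). A vertex z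
adjacent to D but not to the second support detects the difference. Hence deleting D, its outer
boundary and the neighbours of z leaves a definite set (`posDefOn_of_adj`); when D is large, all but
one of its vertices can be kept.

The deletion is small because degrees are bounded. After switching, there is an independent 39-set
in which every other vertex has at most five neighbours, and the Schur complement of that set
(`schur_star`) bounds all degrees. -/

/-- The bilinear form of the matrix `4I - 2A`, where `A` is the adjacency matrix of `G`. -/
def gapForm (v w : V → ℝ) : ℝ :=
  4 * ∑ x, v x * w x - 2 * ∑ x, v x * ∑ y ∈ G.neighborFinset x, w y

/-- The form of `4I - 2A` is positive definite on vectors supported in `U`. -/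
def PosDefOn (U : Finset V) : Prop :=
  ∀ v : V → ℝ, (∀ x ∉ U, v x = 0) → v ≠ 0 → 0 < gapForm G v v

variable {G}

theorem gapForm_eq_sum_adj (v w : V → ℝ) :
    gapForm G v w = 4 * ∑ x, v x * w x - 2 * ∑ x, ∑ y, if G.Adj x y then v x * w y else 0 := by
  unfold gapForm
  congr 2
  refine Finset.sum_congr rfl fun x _ => ?_
  rw [Finset.mul_sum, ← Finset.sum_filter]
  refine Finset.sum_congr ?_ fun _ _ => rfl
  ext y; simp

theorem gapForm_comm (v w : V → ℝ) : gapForm G v w = gapForm G w v := by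
  rw [gapForm_eq_sum_adj, gapForm_eq_sum_adj, Finset.sum_comm]
  simp only [G.adj_comm, mul_comm]

theorem gapForm_add_left (u v w : V → ℝ) :
    gapForm G (u + v) w = gapForm G u w + gapForm G v w := by
  simp only [gapForm, Pi.add_apply, add_mul, Finset.sum_add_distrib]; ring

theorem gapForm_smul_left (c : ℝ) (v w : V → ℝ) :
    gapForm G (c • v) w = c * gapForm G v w := by
  simp only [gapForm, Pi.smul_apply, smul_eq_mul, mul_assoc, ← Finset.mul_sum]; ring

theorem gapForm_add_right (u v w : V → ℝ) :
    gapForm G u (v + w) = gapForm G u v + gapForm G u w := by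
  rw [gapForm_comm, gapForm_add_left, gapForm_comm v, gapForm_comm w]

theorem gapForm_smul_right (c : ℝ) (v w : V → ℝ) :
    gapForm G v (c • w) = c * gapForm G v w := by
  rw [gapForm_comm, gapForm_smul_left, gapForm_comm]

theorem gapForm_sub_left (u v w : V → ℝ) :
    gapForm G (u - v) w = gapForm G u w - gapForm G v w := by
  have := gapForm_add_left (G := G) u ((-1 : ℝ) • v) w
  rw [gapForm_smul_left] at this
  have h : u - v = u + (-1 : ℝ) • v := by ext; simp [sub_eq_add_neg]
  rw [h, this]; ring

theorem gapForm_sub_right (u v w : V → ℝ) :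
    gapForm G u (v - w) = gapForm G u v - gapForm G u w := by
  rw [gapForm_comm, gapForm_sub_left, gapForm_comm v, gapForm_comm w]

theorem gapForm_add_self (u v : V → ℝ) :
    gapForm G (u + v) (u + v) = gapForm G u u + 2 * gapForm G u v + gapForm G v v := by
  rw [gapForm_add_left, gapForm_add_right, gapForm_add_right, gapForm_comm v u]; ring

theorem gapForm_eq_sum_left (v w : V → ℝ) :
    gapForm G v w = ∑ x, v x * (4 * w x - 2 * ∑ y ∈ G.neighborFinset x, w y) := by
  unfold gapForm
  rw [Finset.mul_sum, Finset.mul_sum, ← Finset.sum_sub_distrib]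
  exact Finset.sum_congr rfl fun x _ => by ring

theorem gapForm_single_left (z : V) (w : V → ℝ) :
    gapForm G (Pi.single z 1) w = 4 * w z - 2 * ∑ y ∈ G.neighborFinset z, w y := by
  rw [gapForm_eq_sum_left, Finset.sum_eq_single z]
  · simp
  · intro b _ hb; simp [hb]
  · simp

theorem gapForm_single_self (z : V) :
    gapForm G (Pi.single z 1) (Pi.single z 1) = 4 := by
  rw [gapForm_single_left, Finset.sum_eq_zero]
  · simp
  · intro y hy
    have : y ≠ z := by rintro rfl; simp at hy
    simp [this]

/-- Vectors with disjoint, mutually non-adjacent supports are orthogonal. -/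
theorem gapForm_eq_zero {v w : V → ℝ} (h : ∀ x, v x ≠ 0 → w x = 0)
    (h' : ∀ x y, G.Adj x y → v x ≠ 0 → w y = 0) : gapForm G v w = 0 := by
  rw [gapForm_eq_sum_left]
  refine Finset.sum_eq_zero fun x _ => ?_
  by_cases hx : v x = 0
  · simp [hx]
  · rw [h x hx, Finset.sum_eq_zero fun y hy => h' x y (by simpa using hy) hx]; simp

/-- The off-diagonal entries of 4I − 2A are nonpositive, so passing to absolute values can only
lower the form. Failure of definiteness is therefore always witnessed by a nonnegative vector, whose
coordinate sum is positive. -/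
theorem gapForm_abs_le (v : V → ℝ) : gapForm G |v| |v| ≤ gapForm G v v := by
  rw [gapForm_eq_sum_adj, gapForm_eq_sum_adj]
  have h1 : ∑ x, |v| x * |v| x = ∑ x, v x * v x :=
    Finset.sum_congr rfl fun x _ => by simp [Pi.abs_apply]
  have h2 : ∑ x, ∑ y, (if G.Adj x y then v x * v y else 0) ≤
      ∑ x, ∑ y, (if G.Adj x y then |v| x * |v| y else 0) := by
    refine Finset.sum_le_sum fun x _ => Finset.sum_le_sum fun y _ => ?_
    split_ifs
    · rw [Pi.abs_apply, Pi.abs_apply, ← abs_mul]; exact le_abs_self _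
    · rfl
  rw [h1]; linarith

theorem exists_nonneg_of_not_posDefOn {U : Finset V} (h : ¬ PosDefOn G U) :
    ∃ v : V → ℝ, 0 ≤ v ∧ v ≠ 0 ∧ (∀ x ∉ U, v x = 0) ∧ gapForm G v v ≤ 0 := by
  unfold PosDefOn at h
  push Not at h
  obtain ⟨v, h1, h2, h3⟩ := h
  refine ⟨|v|, abs_nonneg v, by simpa using h2, fun x hx => by simp [Pi.abs_apply, h1 x hx], ?_⟩
  exact (gapForm_abs_le v).trans h3

theorem sum_pos_of_nonneg_ne_zero {v : V → ℝ} (hv : 0 ≤ v) (h : v ≠ 0) : 0 < ∑ x, v x := by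
  obtain ⟨x, hx⟩ := Function.ne_iff.1 h
  exact Finset.sum_pos' (fun i _ => hv i) ⟨x, Finset.mem_univ x, lt_of_le_of_ne (hv x) (Ne.symm hx)⟩

/-- If `4I + J - 2A` is positive semidefinite, two orthogonal nonzero nonnegative vectors on which
the form of `4I - 2A` is nonpositive are isotropic, and proportional modulo the radical. -/
theorem isotropic_of_orthogonal (hM : ∀ v : V → ℝ, 0 ≤ gapForm G v v + (∑ x, v x) ^ 2)
    {a b : V → ℝ} (ha : 0 ≤ a) (ha0 : a ≠ 0) (hb : 0 ≤ b) (hb0 : b ≠ 0)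
    (hab : gapForm G a b = 0) (haa : gapForm G a a ≤ 0) (hbb : gapForm G b b ≤ 0) :
    gapForm G a a = 0 ∧ gapForm G b b = 0 ∧
      ∀ y, (∑ x, b x) * gapForm G a y = (∑ x, a x) * gapForm G b y := by
  have hsa := sum_pos_of_nonneg_ne_zero ha ha0
  have hsb := sum_pos_of_nonneg_ne_zero hb hb0
  set s := ∑ x, a x
  set t := ∑ x, b x
  -- The combination t·a − s·b has coordinate sum zero, so J does not see it.
  have hsum : ∀ (c : ℝ) (y : V → ℝ), ∑ x, (c • (t • a - s • b) + y) x = ∑ x, y x := by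
    intro c y
    simp only [Pi.add_apply, Pi.smul_apply, Pi.sub_apply, smul_eq_mul, Finset.sum_add_distrib,
      ← Finset.mul_sum, Finset.sum_sub_distrib]
    change c * (t * s - s * t) + _ = _
    ring
  have hww : gapForm G (t • a - s • b) (t • a - s • b) =
      t ^ 2 * gapForm G a a + s ^ 2 * gapForm G b b := by
    simp only [gapForm_sub_left, gapForm_sub_right, gapForm_smul_left, gapForm_smul_right,
      gapForm_comm b a, hab]
    ring
  have h0 := hM ((1 : ℝ) • (t • a - s • b) + 0)
  rw [hsum, one_smul, add_zero, hww] at h0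
  simp only [Pi.zero_apply, Finset.sum_const_zero] at h0
  have ht2 : 0 < t ^ 2 := by positivity
  have hs2 : 0 < s ^ 2 := by positivity
  have e1 : gapForm G a a = 0 := by nlinarith
  have e2 : gapForm G b b = 0 := by nlinarith
  refine ⟨e1, e2, fun y => ?_⟩
  have key : ∀ c : ℝ, 0 ≤ 2 * c * (t * gapForm G a y - s * gapForm G b y) +
      (gapForm G y y + (∑ x, y x) ^ 2) := by
    intro c
    have := hM (c • (t • a - s • b) + y)
    rw [hsum, gapForm_add_self, gapForm_smul_left, gapForm_smul_left, gapForm_smul_right, hww,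
      e1, e2, gapForm_sub_left, gapForm_smul_left, gapForm_smul_left] at this
    linarith
  by_contra hne
  set e := t * gapForm G a y - s * gapForm G b y with he
  have hene : e ≠ 0 := sub_ne_zero.2 hne
  set K := gapForm G y y + (∑ x, y x) ^ 2
  -- The lower bound in `key` is affine in c with slope 2e; this c makes it equal to −1.
  have := key (-(K + 1) / (2 * e))
  have h' : 2 * (-(K + 1) / (2 * e)) * e = -(K + 1) := by field_simp
  rw [h'] at this
  linarith

/-- Restricting a nonnegative vector on which the form is nonpositive to a part of its support
that splits off from the rest. -/
theorem gapForm_restrict_add (v : V → ℝ) (T : Finset V)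
    (h : ∀ x ∈ T, ∀ y ∉ T, G.Adj x y → v x = 0 ∨ v y = 0) :
    gapForm G v v = gapForm G (fun x => if x ∈ T then v x else 0) (fun x => if x ∈ T then v x else 0)
      + gapForm G (fun x => if x ∈ T then 0 else v x) (fun x => if x ∈ T then 0 else v x) := by
  have hv : v = (fun x => if x ∈ T then v x else 0) + (fun x => if x ∈ T then 0 else v x) := by
    ext x; simp only [Pi.add_apply]; split_ifs <;> simp
  conv_lhs => rw [hv]
  rw [gapForm_add_self, gapForm_eq_zero (v := fun x => if x ∈ T then v x else 0)
    (w := fun x => if x ∈ T then 0 else v x)]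
  · ring
  · intro x hx
    by_cases hT : x ∈ T
    · simp [hT]
    · simp [hT] at hx
  · intro x y hxy hx
    by_cases hT : x ∈ T
    · by_cases hy : y ∈ T
      · simp [hy]
      · simp only [hT, if_true] at hx
        simp only [hy, if_false]
        exact (h x hT y hy hxy).resolve_left hx
    · simp [hT] at hx

/-- If `u` is positive exactly on `D` with nonpositive form and `z` is an outer neighbour of `D`,
the form is definite on the vertices far from `D` and from `z`, together with a definite part of
`D`. -/
theorem posDefOn_of_adj (hM : ∀ v : V → ℝ, 0 ≤ gapForm G v v + (∑ x, v x) ^ 2)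
    {D T U : Finset V} {u : V → ℝ} (hu : ∀ x ∈ D, 0 < u x) (hu' : ∀ x ∉ D, u x = 0)
    (huu : gapForm G u u ≤ 0) (hTD : T ⊆ D) (hT : PosDefOn G T) {z d : V} (hz : z ∉ D) (hd : d ∈ D)
    (hzd : G.Adj z d) (hU : ∀ x ∈ U, x ∉ T → x ∉ D ∧ ∀ y ∈ D, ¬ G.Adj x y)
    (hUz : ∀ x ∈ U, ¬ G.Adj z x) : PosDefOn G U := by
  by_contra hne
  obtain ⟨v, hv, hv0, hvU, hvv⟩ := exists_nonneg_of_not_posDefOn hne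
  have hu0 : 0 ≤ u := fun x => by
    by_cases hx : x ∈ D
    · exact (hu x hx).le
    · simp [hu' x hx]
  have hune : u ≠ 0 := fun h => by have := hu d hd; simp [h] at this
  have hsplit := gapForm_restrict_add (G := G) v T (by
    intro x hx y hy hxy
    by_contra hcon
    push Not at hcon
    have hyU : y ∈ U := by by_contra h; exact hcon.2 (hvU y h)
    exact (hU y hyU hy).2 x (hTD hx) hxy.symm)
  set vT : V → ℝ := fun x => if x ∈ T then v x else 0 with hvT
  set vF : V → ℝ := fun x => if x ∈ T then 0 else v x with hvF
  have hFsupp : ∀ x, vF x ≠ 0 → x ∈ U ∧ x ∉ T := by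
    intro x hx
    by_cases hxT : x ∈ T
    · simp [hvF, hxT] at hx
    · refine ⟨?_, hxT⟩
      by_contra h
      simp [hvF, hvU x h] at hx
  have hvF0 : 0 ≤ vF := fun x => by
    by_cases hxT : x ∈ T
    · simp [hvF, hxT]
    · simpa [hvF, hxT] using hv x
  have hTn : 0 ≤ gapForm G vT vT := by
    by_cases h : vT = 0
    · simp [h, gapForm]
    · exact (hT vT (fun x hx => by simp [hvT, hx]) h).le
  have hFne : vF ≠ 0 := by
    intro h
    have hvTv : vT = v := by
      ext x
      have := congrFun h x
      by_cases hxT : x ∈ T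
      · simp [hvT, hxT]
      · simp only [hvF, hxT, if_false, Pi.zero_apply] at this
        simp [hvT, hxT, this]
    have := hT vT (fun x hx => by simp [hvT, hx]) (by rw [hvTv]; exact hv0)
    rw [hvTv] at this
    linarith
  have huF : gapForm G u vF = 0 := by
    refine gapForm_eq_zero ?_ ?_
    · intro x hx
      by_contra h
      exact hx (hu' x (hU x (hFsupp x h).1 (hFsupp x h).2).1)
    · intro x y hxy hx
      by_contra h
      obtain ⟨h1, h2⟩ := hFsupp y h
      have hxD : x ∈ D := by by_contra h; exact hx (hu' x h)
      exact (hU y h1 h2).2 x hxD hxy.symm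
  -- Pairing with the basis vector at z separates the two vectors: `u` gives a negative value, `vF`
  -- gives zero.
  obtain ⟨-, -, hy⟩ := isotropic_of_orthogonal hM hu0 hune hvF0 hFne huF huu (by linarith)
  have hy := hy (Pi.single z 1)
  rw [gapForm_comm u, gapForm_comm vF, gapForm_single_left, gapForm_single_left, hu' z hz] at hy
  have hz0 : vF z = 0 := by
    by_contra h
    obtain ⟨h1, h2⟩ := hFsupp z h
    exact (hU z h1 h2).2 d hd hzd
  have hs : ∑ y ∈ G.neighborFinset z, vF y = 0 := Finset.sum_eq_zero fun y hyz => by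
    by_contra h
    exact hUz y (hFsupp y h).1 (by simpa using hyz)
  have h1 : 0 < ∑ y ∈ G.neighborFinset z, u y :=
    Finset.sum_pos' (fun i _ => hu0 i) ⟨d, by simpa using hzd, hu d hd⟩
  have h2 := mul_pos (sum_pos_of_nonneg_ne_zero hvF0 hFne) h1
  rw [hz0, hs] at hy
  linarith

/-- The analogue of `posDefOn_of_adj` when `D` has no outer neighbours. -/
theorem posDefOn_of_isolated (hM : ∀ v : V → ℝ, 0 ≤ gapForm G v v + (∑ x, v x) ^ 2)
    {D T U : Finset V} {u : V → ℝ} (hu : 0 ≤ u) (hu0 : u ≠ 0) (hu' : ∀ x ∉ D, u x = 0)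
    (huu : gapForm G u u ≤ 0) (hTD : T ⊆ D) (hT : PosDefOn G T)
    (hD : ∀ x ∈ D, ∀ y ∉ D, ¬ G.Adj x y) (hU : ∀ x ∈ U, x ∉ T → x ∉ D)
    {y : V → ℝ} (hy : gapForm G y y < 0) : PosDefOn G U := by
  by_contra hne
  obtain ⟨v, hv, hv0, hvU, hvv⟩ := exists_nonneg_of_not_posDefOn hne
  have hsplit := gapForm_restrict_add (G := G) v T (by
    intro x hx y hy hxy
    by_contra hcon
    push Not at hcon
    have hyU : y ∈ U := by by_contra h; exact hcon.2 (hvU y h)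
    exact hD x (hTD hx) y (hU y hyU hy) hxy)
  set vT : V → ℝ := fun x => if x ∈ T then v x else 0 with hvT
  set vF : V → ℝ := fun x => if x ∈ T then 0 else v x with hvF
  have hFsupp : ∀ x, vF x ≠ 0 → x ∉ D := by
    intro x hx
    by_cases hxT : x ∈ T
    · simp [hvF, hxT] at hx
    · refine hU x ?_ hxT
      by_contra h
      simp [hvF, hvU x h] at hx
  have hvF0 : 0 ≤ vF := fun x => by
    by_cases hxT : x ∈ T
    · simp [hvF, hxT]
    · simpa [hvF, hxT] using hv x
  have hTn : 0 ≤ gapForm G vT vT := by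
    by_cases h : vT = 0
    · simp [h, gapForm]
    · exact (hT vT (fun x hx => by simp [hvT, hx]) h).le
  have hFne : vF ≠ 0 := by
    intro h
    have hvTv : vT = v := by
      ext x
      have := congrFun h x
      by_cases hxT : x ∈ T
      · simp [hvT, hxT]
      · simp only [hvF, hxT, if_false, Pi.zero_apply] at this
        simp [hvT, hxT, this]
    have := hT vT (fun x hx => by simp [hvT, hx]) (by rw [hvTv]; exact hv0)
    rw [hvTv] at this
    linarith
  have orth : ∀ a b : V → ℝ, (∀ x ∉ D, a x = 0) → (∀ x ∈ D, b x = 0) → gapForm G a b = 0 := by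
    intro a b ha hb
    refine gapForm_eq_zero (fun x hx => hb x (by_contra fun h => hx (ha x h))) ?_
    intro x y hxy hx
    have hxD : x ∈ D := by_contra fun h => hx (ha x h)
    by_contra h
    exact hD x hxD y (fun h' => h (hb y h')) hxy
  have hy' : gapForm G |y| |y| < 0 := (gapForm_abs_le y).trans_lt hy
  rw [gapForm_restrict_add |y| D (fun x hx y hy hxy => absurd hxy (hD x hx y hy))] at hy'
  set yD : V → ℝ := fun x => if x ∈ D then |y| x else 0 with hyD
  set yF : V → ℝ := fun x => if x ∈ D then 0 else |y| x with hyF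
  have hyD0 : 0 ≤ yD := fun x => by simp only [hyD]; split_ifs <;> simp [Pi.abs_apply]
  have hyF0 : 0 ≤ yF := fun x => by simp only [hyF]; split_ifs <;> simp [Pi.abs_apply]
  -- One half of |y| has negative form. It is orthogonal to `vF` or to `u`, so it would have to be
  -- isotropic.
  rcases lt_or_ge (gapForm G yD yD) 0 with h | h
  · have hne : yD ≠ 0 := by intro h'; simp [h', gapForm] at h
    have := (isotropic_of_orthogonal hM hyD0 hne hvF0 hFne
      (orth _ _ (fun x hx => by simp [hyD, hx]) (fun x hx => by_contra fun h => hFsupp x h hx))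
      h.le (by linarith)).1
    linarith
  · have h : gapForm G yF yF < 0 := by linarith
    have hne : yF ≠ 0 := by intro h'; simp [h', gapForm] at h
    have := (isotropic_of_orthogonal hM hu hu0 hyF0 hne
      (orth _ _ hu' (fun x hx => by simp [hyF, hx])) huu h.le).2.1
    linarith

end GapForm

/-! ### Rank estimates for 4I − 2A and 4I + J − 2A -/

section Rank

variable {V : Type*} [Fintype V] [DecidableEq V] (G : SimpleGraph V) [DecidableRel G.Adj]

/-- The matrix `4I - 2A`. -/
def gapMatrix : Matrix V V ℝ := (4 : ℝ) • 1 - (2 : ℝ) • G.adjMatrix ℝ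

variable {G}

theorem gapMatrix_mulVec_apply (v : V → ℝ) (x : V) :
    (gapMatrix G *ᵥ v) x = 4 * v x - 2 * ∑ y ∈ G.neighborFinset x, v y := by
  simp [gapMatrix, sub_mulVec, smul_mulVec, SimpleGraph.adjMatrix_mulVec_apply]

theorem dotProduct_gapMatrix_mulVec (v w : V → ℝ) :
    v ⬝ᵥ (gapMatrix G *ᵥ w) = gapForm G v w := by
  rw [gapForm_eq_sum_left]
  simp only [dotProduct, gapMatrix_mulVec_apply]

theorem gapMatrix_isHermitian : (gapMatrix G).IsHermitian := by
  unfold gapMatrix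
  rw [IsHermitian, conjTranspose_eq_transpose_of_trivial, transpose_sub, transpose_smul,
    transpose_smul, transpose_one, SimpleGraph.transpose_adjMatrix]

theorem add_ones_mulVec (v : V → ℝ) :
    (gapMatrix G + of fun _ _ => (1 : ℝ)) *ᵥ v = gapMatrix G *ᵥ v + fun _ => ∑ x, v x := by
  rw [add_mulVec]
  congr 1
  ext x
  simp [mulVec, dotProduct]

theorem dotProduct_add_ones_mulVec (v w : V → ℝ) :
    v ⬝ᵥ ((gapMatrix G + of fun _ _ => (1 : ℝ)) *ᵥ w) =
      gapForm G v w + (∑ x, v x) * ∑ x, w x := by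
  rw [add_ones_mulVec, dotProduct_add, dotProduct_gapMatrix_mulVec]
  simp [dotProduct, Finset.sum_mul]

/-- Adding J only increases the form, so no nonzero vector supported in U lies in the kernel. -/
theorem card_le_rank_of_posDefOn {U : Finset V} (hU : PosDefOn G U) :
    U.card ≤ (gapMatrix G + of fun _ _ => (1 : ℝ)).rank := by
  set M := gapMatrix G + of fun _ _ => (1 : ℝ) with hMdef
  let E : (U → ℝ) →ₗ[ℝ] (V → ℝ) := Function.ExtendByZero.linearMap ℝ (Subtype.val : U → V)
  have hE : ∀ f x, E f x = if h : x ∈ U then f ⟨x, h⟩ else 0 := by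
    intro f x
    split_ifs with h
    · exact Subtype.val_injective.extend_apply f 0 ⟨x, h⟩
    · exact Function.extend_apply' _ _ _ (by rintro ⟨⟨a, ha⟩, rfl⟩; exact h ha)
  have hinj : Function.Injective (M.mulVecLin ∘ₗ E) := by
    rw [injective_iff_map_eq_zero]
    intro f hf
    by_contra hne
    have hEne : E f ≠ 0 := by
      intro h
      apply hne
      ext ⟨x, hx⟩
      have := congrFun h x
      rw [hE, dif_pos hx] at this
      simpa using this
    have h1 := hU (E f) (fun x hx => by rw [hE, dif_neg hx]) hEne
    have h2 := dotProduct_add_ones_mulVec (G := G) (E f) (E f)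
    have h3 : M *ᵥ E f = 0 := by simpa using hf
    rw [← hMdef, h3, dotProduct_zero] at h2
    nlinarith [mul_self_nonneg (∑ x, E f x)]
  have h1 := LinearMap.finrank_range_of_inj hinj
  have h2 : LinearMap.range (M.mulVecLin ∘ₗ E) ≤ LinearMap.range M.mulVecLin :=
    LinearMap.range_comp_le_range _ _
  have h3 := Submodule.finrank_mono h2
  rw [h1] at h3
  simpa [Matrix.rank] using h3

/-- Cauchy–Schwarz over the nonzero eigenvalues, whose number is the rank. -/
theorem trace_sq_le_rank_mul {A : Matrix V V ℝ} (hA : A.IsHermitian) :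
    A.trace ^ 2 ≤ A.rank * (A * A).trace := by
  have h1 : A.trace = ∑ i, hA.eigenvalues i := by
    simpa using hA.trace_eq_sum_eigenvalues
  have h2 : (A * A).trace = ∑ i, hA.eigenvalues i ^ 2 := by
    have hs := hA.spectral_theorem
    rw [Unitary.conjStarAlgAut_apply] at hs
    set W : Matrix V V ℝ := (hA.eigenvectorUnitary : Matrix V V ℝ)
    set Dg : Matrix V V ℝ := diagonal (RCLike.ofReal ∘ hA.eigenvalues) with hDg
    have hW : star W * W = 1 := Unitary.coe_star_mul_self hA.eigenvectorUnitary
    have h3 : A * A = W * (Dg * Dg) * star W := by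
      conv_lhs => rw [hs]
      calc W * Dg * star W * (W * Dg * star W) = W * Dg * (star W * W) * Dg * star W := by
            simp only [Matrix.mul_assoc]
        _ = _ := by rw [hW]; simp only [Matrix.mul_assoc, Matrix.one_mul]
    rw [h3, trace_mul_comm, ← Matrix.mul_assoc, hW, Matrix.one_mul, hDg, diagonal_mul_diagonal,
      trace_diagonal]
    exact Finset.sum_congr rfl fun i _ => by simp [sq]
  rw [h1, h2, hA.rank_eq_card_non_zero_eigs, Fintype.card_subtype]
  have h4 : ∑ i, hA.eigenvalues i = ∑ i with hA.eigenvalues i ≠ 0, hA.eigenvalues i :=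
    (Finset.sum_filter_ne_zero _).symm
  have h5 : ∑ i with hA.eigenvalues i ≠ 0, hA.eigenvalues i ^ 2 ≤ ∑ i, hA.eigenvalues i ^ 2 :=
    Finset.sum_le_sum_of_subset_of_nonneg (Finset.filter_subset _ _) fun i _ _ => sq_nonneg _
  rw [h4]
  exact sq_sum_le_card_mul_sum_sq.trans (mul_le_mul_of_nonneg_left h5 (by positivity))

/-- A positive semidefinite `4I - 2A` has rank at least two thirds of its order. -/
theorem two_mul_card_le_rank_gapMatrix [Nonempty V] (h : ∀ v : V → ℝ, 0 ≤ gapForm G v v) :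
    2 * (Fintype.card V : ℝ) ≤ 3 * (gapMatrix G).rank := by
  have h1 := trace_sq_le_rank_mul (gapMatrix_isHermitian (G := G))
  have ht : (gapMatrix G).trace = 4 * Fintype.card V := by
    simp [gapMatrix, trace_sub, trace_smul]
  have ht2 : (gapMatrix G * gapMatrix G).trace =
      16 * Fintype.card V + 4 * ∑ x, (G.degree x : ℝ) := by
    have : gapMatrix G * gapMatrix G = (16 : ℝ) • 1 - (16 : ℝ) • G.adjMatrix ℝ +
        (4 : ℝ) • (G.adjMatrix ℝ * G.adjMatrix ℝ) := by
      unfold gapMatrix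
      simp only [sub_mul, mul_sub, smul_mul_assoc, mul_smul_comm, Matrix.one_mul, Matrix.mul_one]
      module
    rw [this, trace_add, trace_sub, trace_smul, trace_smul, trace_smul, trace_one,
      SimpleGraph.trace_adjMatrix]
    simp only [smul_eq_mul, mul_zero, sub_zero, trace, diag_apply,
      SimpleGraph.adjMatrix_mul_self_apply_self]
  -- The all-ones vector shows that the degrees sum to at most twice the order.
  have hd := h fun _ => 1
  simp only [gapForm, mul_one, Finset.sum_const, Finset.card_univ, nsmul_eq_mul, one_mul,
    SimpleGraph.card_neighborFinset_eq_degree] at hd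
  have hn : (0 : ℝ) < Fintype.card V := by exact_mod_cast Fintype.card_pos
  have hr : (0 : ℝ) ≤ (gapMatrix G).rank := by positivity
  rw [ht, ht2] at h1
  have h3 : (4 * (Fintype.card V : ℝ)) ^ 2 ≤ (gapMatrix G).rank * (24 * Fintype.card V) :=
    h1.trans (mul_le_mul_of_nonneg_left (by linarith) hr)
  have h4 : 2 * (Fintype.card V : ℝ) * (8 * Fintype.card V) ≤
      3 * (gapMatrix G).rank * (8 * Fintype.card V) := by linarith
  exact le_of_mul_le_mul_right h4 (by positivity)

theorem rank_bound_of_posSemidef (hn : 3 ≤ Fintype.card V)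
    (h : ∀ v : V → ℝ, 0 ≤ gapForm G v v) :
    2 * (Fintype.card V : ℝ) + 3 ≤ 3 * (gapMatrix G + of fun _ _ => (1 : ℝ)).rank := by
  have : Nonempty V := Fintype.card_pos_iff.1 (by omega)
  set M := gapMatrix G + of fun _ _ => (1 : ℝ) with hMdef
  by_cases hpd : PosDefOn G (univ : Finset V)
  · have := card_le_rank_of_posDefOn hpd
    rw [Finset.card_univ] at this
    have h1 : (Fintype.card V : ℝ) ≤ M.rank := by exact_mod_cast this
    have h2 : (3 : ℝ) ≤ Fintype.card V := by exact_mod_cast hn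
    linarith
  obtain ⟨u, hu, hu0, -, huu⟩ := exists_nonneg_of_not_posDefOn hpd
  have hker : ∀ v : V → ℝ, gapForm G v v ≤ 0 → gapMatrix G *ᵥ v = 0 := by
    intro v hv
    have key : ∀ w, gapForm G v w = 0 := by
      intro w
      by_contra hne
      have := h ((-(gapForm G w w + 1) / (2 * gapForm G v w)) • v + w)
      rw [gapForm_add_self, gapForm_smul_left, gapForm_smul_left, gapForm_smul_right,
        le_antisymm hv (h v)] at this
      have h' : 2 * (-(gapForm G w w + 1) / (2 * gapForm G v w) * gapForm G v w) =
        -(gapForm G w w + 1) := by field_simp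
      rw [h'] at this
      linarith
    ext x
    have := key (Pi.single x 1)
    rw [gapForm_comm, gapForm_single_left] at this
    rw [gapMatrix_mulVec_apply, this]; rfl
  -- Both summands of the form of M are nonnegative, which gives the inclusion. It is strict because
  -- u is in the larger kernel and has positive coordinate sum.
  have hlt : LinearMap.ker M.mulVecLin < LinearMap.ker (gapMatrix G).mulVecLin := by
    refine lt_of_le_of_ne ?_ ?_
    · intro v hv
      rw [LinearMap.mem_ker, mulVecLin_apply] at hv ⊢
      have h1 := dotProduct_add_ones_mulVec (G := G) v v
      rw [← hMdef, hv, dotProduct_zero] at h1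
      exact hker v (by nlinarith [mul_self_nonneg (∑ x, v x)])
    · intro heq
      have h1 : u ∈ LinearMap.ker M.mulVecLin := by
        rw [heq, LinearMap.mem_ker, mulVecLin_apply]
        exact hker u huu
      rw [LinearMap.mem_ker, mulVecLin_apply] at h1
      have h2 := dotProduct_add_ones_mulVec (G := G) u u
      rw [← hMdef, h1, dotProduct_zero] at h2
      have := sum_pos_of_nonneg_ne_zero hu hu0
      nlinarith [h u]
  have h1 := Submodule.finrank_lt_finrank_of_lt hlt
  have h2 := LinearMap.finrank_range_add_finrank_ker M.mulVecLin
  have h3 := LinearMap.finrank_range_add_finrank_ker (gapMatrix G).mulVecLin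
  have h4 : (gapMatrix G).rank + 1 ≤ M.rank := by
    unfold Matrix.rank
    omega
  have h5 := two_mul_card_le_rank_gapMatrix h
  have h6 : ((gapMatrix G).rank : ℝ) + 1 ≤ M.rank := by exact_mod_cast h4
  linarith

end Rank

/-! ### Degree bounds from an independent 39-set -/

section Degrees

variable {V : Type*} [Fintype V] [DecidableEq V] {G : SimpleGraph V} [DecidableRel G.Adj]

/-- The indicator vector of a finite set. -/
def indVec (X : Finset V) : V → ℝ := fun x => if x ∈ X then 1 else 0

theorem gapForm_ite_left (X : Finset V) (f w : V → ℝ) :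
    gapForm G (fun x => if x ∈ X then f x else 0) w =
      ∑ x ∈ X, f x * (4 * w x - 2 * ∑ y ∈ G.neighborFinset x, w y) := by
  rw [gapForm_eq_sum_left]
  simp [Finset.sum_ite_mem]

theorem gapForm_indVec_left (X : Finset V) (w : V → ℝ) :
    gapForm G (indVec X) w = ∑ x ∈ X, (4 * w x - 2 * ∑ y ∈ G.neighborFinset x, w y) := by
  have := gapForm_ite_left (G := G) X (fun _ => 1) w
  simp only [one_mul] at this
  exact this

theorem gapForm_indVec_self_le (X : Finset V) :
    gapForm G (indVec X) (indVec X) ≤ 4 * X.card := by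
  rw [gapForm_indVec_left]
  calc _ ≤ ∑ x ∈ X, (4 : ℝ) := Finset.sum_le_sum fun x hx => by
        have : 0 ≤ ∑ y ∈ G.neighborFinset x, indVec X y :=
          Finset.sum_nonneg fun y _ => by unfold indVec; split_ifs <;> norm_num
        have h1 : indVec X x = 1 := by simp [indVec, hx]
        rw [h1]; linarith
    _ = _ := by simp [mul_comm]

/-- The Schur complement of an independent set in a positive semidefinite `4I + J - 2A`. -/
theorem schur_independent (hM : ∀ v : V → ℝ, 0 ≤ gapForm G v v + (∑ x, v x) ^ 2)
    {A : Finset V} (hA : ∀ a ∈ A, ∀ b ∈ A, ¬ G.Adj a b) (y : V → ℝ) (hy : ∀ a ∈ A, y a = 0) :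
    0 ≤ gapForm G y y - ∑ a ∈ A, (∑ x ∈ G.neighborFinset a, y x) ^ 2 +
      4 * (∑ x, y x + (∑ a ∈ A, ∑ x ∈ G.neighborFinset a, y x) / 2) ^ 2 / (A.card + 4) := by
  set r : V → ℝ := fun a => ∑ x ∈ G.neighborFinset a, y x with hr
  set k : ℝ := ∑ x, y x + (∑ a ∈ A, r a) / 2 with hk
  set m : ℝ := (A.card : ℝ) with hm
  have hm0 : 0 ≤ m := by positivity
  set t : ℝ := k / (m + 4) with ht
  set f : V → ℝ := fun x => if x ∈ A then r x / 2 - t else 0 with hf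
  have h0 := hM (y + f)
  have hfy : gapForm G f y = ∑ a ∈ A, (r a / 2 - t) * (-2 * r a) := by
    rw [hf, gapForm_ite_left]
    refine Finset.sum_congr rfl fun a ha => ?_
    rw [hy a ha]; ring
  have hff : gapForm G f f = ∑ a ∈ A, 4 * (r a / 2 - t) ^ 2 := by
    conv_lhs => rw [hf, gapForm_ite_left]
    refine Finset.sum_congr rfl fun a ha => ?_
    rw [Finset.sum_eq_zero fun b hb => ?_]
    · simp only [ha, if_true]; ring
    · have : b ∉ A := fun hbA => hA a ha b hbA (by simpa using hb)
      simp [this]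
  have hsum : ∑ x, (y + f) x = k - m * t := by
    simp only [Pi.add_apply, Finset.sum_add_distrib, hf, Finset.sum_ite_mem, Finset.univ_inter,
      Finset.sum_sub_distrib, Finset.sum_const, nsmul_eq_mul, ← Finset.sum_div]
    rw [hk]; ring
  have hcomb : 2 * ∑ a ∈ A, (r a / 2 - t) * (-2 * r a) + ∑ a ∈ A, 4 * (r a / 2 - t) ^ 2 =
      - ∑ a ∈ A, r a ^ 2 + 4 * m * t ^ 2 := by
    rw [Finset.mul_sum, ← Finset.sum_add_distrib]
    have : ∀ a ∈ A, 2 * ((r a / 2 - t) * (-2 * r a)) + 4 * (r a / 2 - t) ^ 2 =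
        - r a ^ 2 + 4 * t ^ 2 := fun a _ => by ring
    rw [Finset.sum_congr rfl this, Finset.sum_add_distrib, Finset.sum_neg_distrib,
      Finset.sum_const, nsmul_eq_mul]
    ring
  rw [gapForm_add_self, gapForm_comm y f, hfy, hff, hsum] at h0
  have hkt : k = t * (m + 4) := by rw [ht]; field_simp
  have h4 : 4 * k ^ 2 / (m + 4) = 4 * m * t ^ 2 + (k - m * t) ^ 2 := by
    rw [hkt]; field_simp; ring
  change 0 ≤ gapForm G y y - ∑ a ∈ A, r a ^ 2 + 4 * k ^ 2 / (m + 4)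
  rw [h4]
  linarith

theorem sum_card_neighbor_inter_comm (A Y : Finset V) :
    ∑ a ∈ A, ∑ x ∈ G.neighborFinset a, indVec Y x =
      ∑ y ∈ Y, ((G.neighborFinset y ∩ A).card : ℝ) := by
  have h1 : ∀ a, ∑ x ∈ G.neighborFinset a, indVec Y x = ∑ y ∈ Y, if G.Adj y a then (1 : ℝ) else 0 := by
    intro a
    unfold indVec
    rw [Finset.sum_ite_mem, ← Finset.sum_filter]
    refine Finset.sum_congr ?_ fun _ _ => rfl
    ext x; simp [G.adj_comm, and_comm]
  simp only [h1]
  rw [Finset.sum_comm]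
  refine Finset.sum_congr rfl fun y _ => ?_
  rw [← Finset.sum_filter, Finset.sum_const, nsmul_eq_mul, mul_one]
  congr 2
  ext x; simp [and_comm]

/-- The Schur complement evaluated on a vertex with a set of its neighbours. -/
theorem schur_star (hM : ∀ v : V → ℝ, 0 ≤ gapForm G v v + (∑ x, v x) ^ 2)
    {A : Finset V} (hA : ∀ a ∈ A, ∀ b ∈ A, ¬ G.Adj a b) (hA0 : A.Nonempty) {x : V} (hx : x ∉ A)
    {Y : Finset V} (hYx : Y ⊆ G.neighborFinset x) (hYA : Disjoint Y A) {c : ℕ}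
    (hc : ∀ y ∈ Y, (G.neighborFinset y ∩ A).card ≤ c) :
    ∃ Q : ℝ, 0 ≤ Q ∧ Q ≤ c * Y.card ∧ ∀ α : ℝ, 0 ≤ α →
      0 ≤ α ^ 2 * (4 - (G.neighborFinset x ∩ A).card) + 4 * Y.card - 4 * α * Y.card
        - Q ^ 2 / A.card
        + 4 * (α * (1 + (G.neighborFinset x ∩ A).card / 2) + Y.card + Q / 2) ^ 2
          / (A.card + 4) := by
  set p : ℝ := ((G.neighborFinset x ∩ A).card : ℝ) with hp
  set d : ℝ := (Y.card : ℝ) with hd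
  refine ⟨∑ a ∈ A, ∑ x ∈ G.neighborFinset a, indVec Y x, ?_, ?_, fun α hα => ?_⟩
  · rw [sum_card_neighbor_inter_comm]
    exact Finset.sum_nonneg fun _ _ => Nat.cast_nonneg _
  · rw [sum_card_neighbor_inter_comm]
    calc _ ≤ ∑ y ∈ Y, (c : ℝ) := Finset.sum_le_sum fun y hy => by exact_mod_cast hc y hy
      _ = _ := by simp [mul_comm, hd]
  set e : V → ℝ := fun a => ∑ x ∈ G.neighborFinset a, indVec Y x with he
  have he0 : ∀ a, 0 ≤ e a := fun a =>
    Finset.sum_nonneg fun y _ => by unfold indVec; split_ifs <;> norm_num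
  set s : V → ℝ := fun a => ∑ y ∈ G.neighborFinset a, (Pi.single x (1 : ℝ) : V → ℝ) y with hs
  have hs1 : ∀ a, s a = if G.Adj x a then 1 else 0 := by
    intro a
    simp [hs, G.adj_comm]
  have hsum_s : ∑ a ∈ A, s a = p := by
    simp only [hs1]
    rw [← Finset.sum_filter, Finset.sum_const, nsmul_eq_mul, mul_one, hp]
    congr 2
    ext; simp [and_comm]
  have hxY : x ∉ Y := fun h => by simpa using hYx h
  have h0 := schur_independent hM hA (α • Pi.single x 1 + indVec Y) (by
    intro a ha
    have h1 : a ≠ x := by rintro rfl; exact hx ha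
    have h2 : a ∉ Y := fun h => Finset.disjoint_left.1 hYA h ha
    simp [indVec, h1, h2])
  have hr : ∀ a, ∑ y ∈ G.neighborFinset a, (α • (Pi.single x 1 : V → ℝ) + indVec Y) y =
      α * s a + e a := by
    intro a
    simp only [Pi.add_apply, Pi.smul_apply, smul_eq_mul, Finset.sum_add_distrib, ← Finset.mul_sum,
      hs, he]
  have hk : ∑ y, (α • (Pi.single x 1 : V → ℝ) + indVec Y) y = α + d := by
    simp [Finset.sum_add_distrib, ← Finset.mul_sum, indVec, hd]
  simp only [hr, hk] at h0
  rw [Finset.sum_add_distrib, ← Finset.mul_sum, hsum_s] at h0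
  -- Edges inside Y only lower the form, so they may be ignored.
  have hform : gapForm G (α • Pi.single x 1 + indVec Y) (α • Pi.single x 1 + indVec Y) ≤
      4 * α ^ 2 - 4 * α * d + 4 * d := by
    rw [gapForm_add_self, gapForm_smul_left, gapForm_smul_left, gapForm_smul_right,
      gapForm_single_self, gapForm_single_left]
    have h1 : indVec Y x = 0 := by simp [indVec, hxY]
    have h2 : ∑ y ∈ G.neighborFinset x, indVec Y y = d := by
      simp [indVec, Finset.sum_ite_mem, Finset.inter_eq_right.2 hYx, hd]
    have h3 := gapForm_indVec_self_le (G := G) Y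
    rw [h1, h2]
    linarith
  -- The cross terms are nonnegative and are dropped; Cauchy–Schwarz handles the squares of e.
  have hsq : α ^ 2 * p + (∑ a ∈ A, e a) ^ 2 / A.card ≤ ∑ a ∈ A, (α * s a + e a) ^ 2 := by
    have hm : (0 : ℝ) < A.card := by exact_mod_cast hA0.card_pos
    have h1 : (∑ a ∈ A, e a) ^ 2 / A.card ≤ ∑ a ∈ A, e a ^ 2 := by
      rw [div_le_iff₀' hm]; exact sq_sum_le_card_mul_sum_sq
    have h2 : α ^ 2 * p + ∑ a ∈ A, e a ^ 2 ≤ ∑ a ∈ A, (α * s a + e a) ^ 2 := by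
      rw [← hsum_s, Finset.mul_sum, ← Finset.sum_add_distrib]
      refine Finset.sum_le_sum fun a _ => ?_
      rw [hs1]
      split_ifs
      · nlinarith [mul_nonneg hα (he0 a)]
      · nlinarith
    linarith
  have hfin : (α + d + (α * p + ∑ a ∈ A, e a) / 2) = α * (1 + p / 2) + d + (∑ a ∈ A, e a) / 2 := by
    ring
  rw [hfin] at h0
  linarith

/-- The number of neighbours in an independent 39-set. -/
theorem card_neighbor_inter (hM : ∀ v : V → ℝ, 0 ≤ gapForm G v v + (∑ x, v x) ^ 2)
    {A : Finset V} (hA : ∀ a ∈ A, ∀ b ∈ A, ¬ G.Adj a b) (hA39 : A.card = 39) {x : V}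
    (hx : x ∉ A) :
    (G.neighborFinset x ∩ A).card ≤ 5 ∨ 34 ≤ (G.neighborFinset x ∩ A).card := by
  obtain ⟨Q, hQ0, hQ, h⟩ := schur_star hM hA (Finset.card_pos.1 (by omega)) hx
    (Y := ∅) (by simp) (by simp) (c := 0) (by simp)
  have hQ0 : Q = 0 := le_antisymm (by simpa using hQ) hQ0
  -- With p neighbours in A this reads p² − 39p + 176 ≥ 0, which fails for 6 ≤ p ≤ 33.
  have h1 := h 1 zero_le_one
  rw [hA39, hQ0] at h1
  by_contra hcon
  push Not at hcon
  set p := (G.neighborFinset x ∩ A).card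
  have h2 : (6 : ℝ) ≤ p := by exact_mod_cast hcon.1
  have h3 : (p : ℝ) ≤ 33 := by exact_mod_cast Nat.le_of_lt_succ hcon.2
  norm_num at h1
  nlinarith

theorem degree_eq_inter_add_sdiff (A : Finset V) (x : V) :
    G.degree x = (G.neighborFinset x ∩ A).card + (G.neighborFinset x \ A).card := by
  rw [← SimpleGraph.card_neighborFinset_eq_degree, Finset.card_inter_add_card_sdiff]

/-- With p neighbours inside A and d outside, `schur_star` bounds d for each p ≤ 5; more neighbours
in A leave room for fewer outside it. -/
theorem degree_le_of_notMem (hM : ∀ v : V → ℝ, 0 ≤ gapForm G v v + (∑ x, v x) ^ 2)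
    {A : Finset V} (hA : ∀ a ∈ A, ∀ b ∈ A, ¬ G.Adj a b) (hA39 : A.card = 39)
    (h5 : ∀ x ∉ A, (G.neighborFinset x ∩ A).card ≤ 5) {x : V} (hx : x ∉ A) :
    G.degree x ≤ 21 ∧ (4 ≤ (G.neighborFinset x ∩ A).card → G.degree x ≤ 9) := by
  obtain ⟨Q, hQ0, hQ, h⟩ := schur_star hM hA (Finset.card_pos.1 (by omega)) hx
    (Y := G.neighborFinset x \ A) Finset.sdiff_subset Finset.sdiff_disjoint (c := 5)
    (fun y hy => h5 y (Finset.mem_sdiff.1 hy).2)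
  have hp := h5 x hx
  rw [degree_eq_inter_add_sdiff A x]
  rw [hA39] at h
  generalize (G.neighborFinset x ∩ A).card = p at *
  generalize (G.neighborFinset x \ A).card = d at *
  have hd0 : (0 : ℝ) ≤ d := by positivity
  have hq1 : 0 ≤ (5 * d - Q) * d := mul_nonneg (by push_cast at hQ; linarith) hd0
  have hq2 : 0 ≤ (5 * d - Q) ^ 2 := sq_nonneg _
  have bound : ∀ k : ℕ, k < d → (k : ℝ) + 1 ≤ d := fun k hk => by exact_mod_cast hk
  -- The multiples of d chosen for α approximately minimise the expression at Q = 5d. The expression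
  -- is concave in Q, and `hq2` with `hq1` reduces it to that endpoint.
  have key : d ≤ if p = 0 then 21 else if p = 1 then 18 else if p = 2 then 14 else
      if p = 3 then 10 else if p = 4 then 5 else 0 := by
    by_contra hcon
    push Not at hcon
    interval_cases p
    · have h1 := bound 21 (by simpa using hcon)
      have h2 := h (0.409 * d) (by positivity)
      have h3 := mul_nonneg hd0 (sub_nonneg.2 h1)
      push_cast at h3
      norm_num at h2
      ring_nf at h2 h3 hq1 hq2
      linarith
    · have h1 := bound 18 (by simpa using hcon)
      have h2 := h (0.471 * d) (by positivity)
      have h3 := mul_nonneg hd0 (sub_nonneg.2 h1)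
      push_cast at h3
      norm_num at h2
      ring_nf at h2 h3 hq1 hq2
      linarith
    · have h1 := bound 14 (by simpa using hcon)
      have h2 := h (0.569 * d) (by positivity)
      have h3 := mul_nonneg hd0 (sub_nonneg.2 h1)
      push_cast at h3
      norm_num at h2
      ring_nf at h2 h3 hq1 hq2
      linarith
    · have h1 := bound 10 (by simpa using hcon)
      have h2 := h (0.75 * d) (by positivity)
      have h3 := mul_nonneg hd0 (sub_nonneg.2 h1)
      push_cast at h3
      norm_num at h2
      ring_nf at h2 h3 hq1 hq2
      linarith
    · have h1 := bound 5 (by simpa using hcon)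
      have h2 := h (1.222 * d) (by positivity)
      have h3 := mul_nonneg hd0 (sub_nonneg.2 h1)
      push_cast at h3
      norm_num at h2
      ring_nf at h2 h3 hq1 hq2
      linarith
    · have h1 := bound 0 (by simpa using hcon)
      have h2 := h (6.2 * d) (by positivity)
      have h3 := mul_nonneg hd0 (sub_nonneg.2 h1)
      push_cast at h3
      norm_num at h2
      ring_nf at h2 h3 hq1 hq2
      linarith
  interval_cases p <;> simp at key ⊢ <;> omega

/-- The Schur complement is taken over A without x. Each neighbour of x already spends one of its
five A-neighbours on x, so at most four remain, and x itself has none. -/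
theorem degree_le_of_mem (hM : ∀ v : V → ℝ, 0 ≤ gapForm G v v + (∑ x, v x) ^ 2)
    {A : Finset V} (hA : ∀ a ∈ A, ∀ b ∈ A, ¬ G.Adj a b) (hA39 : A.card = 39)
    (h5 : ∀ x ∉ A, (G.neighborFinset x ∩ A).card ≤ 5) {x : V} (hx : x ∈ A) :
    G.degree x ≤ 14 := by
  have hc : (A.erase x).card = 38 := by rw [Finset.card_erase_of_mem hx, hA39]
  have hNA : ∀ y ∈ G.neighborFinset x, y ∉ A := fun y hy hyA => hA x hx y hyA (by simpa using hy)
  obtain ⟨Q, hQ0, hQ, h⟩ := schur_star hM (A := A.erase x)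
    (fun a ha b hb => hA a (Finset.mem_of_mem_erase ha) b (Finset.mem_of_mem_erase hb))
    (Finset.card_pos.1 (by omega)) (Finset.notMem_erase x A) (Y := G.neighborFinset x) subset_rfl
    (Finset.disjoint_left.2 fun y hy hyA => hNA y hy (Finset.mem_of_mem_erase hyA)) (c := 4) (by
      intro y hy
      have h1 := h5 y (hNA y hy)
      have h2 : G.neighborFinset y ∩ A.erase x = (G.neighborFinset y ∩ A).erase x := by
        ext; simp only [Finset.mem_inter, Finset.mem_erase]; tauto
      have h3 : x ∈ G.neighborFinset y ∩ A := by
        simpa [hx, G.adj_comm] using hy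
      rw [h2, Finset.card_erase_of_mem h3]
      omega)
  have hp : (G.neighborFinset x ∩ A.erase x).card = 0 := by
    rw [Finset.card_eq_zero, ← Finset.disjoint_iff_inter_eq_empty]
    exact Finset.disjoint_left.2 fun y hy hyA => hNA y hy (Finset.mem_of_mem_erase hyA)
  rw [hc, hp, SimpleGraph.card_neighborFinset_eq_degree] at h
  rw [SimpleGraph.card_neighborFinset_eq_degree] at hQ
  generalize G.degree x = d at *
  have hd0 : (0 : ℝ) ≤ d := by positivity
  have hq1 : 0 ≤ (4 * d - Q) * d := mul_nonneg (by push_cast at hQ; linarith) hd0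
  have hq2 : 0 ≤ (4 * d - Q) ^ 2 := sq_nonneg _
  by_contra hcon
  have h1 : (15 : ℝ) ≤ d := by exact_mod_cast not_le.1 hcon
  have h2 := h (0.419 * d) (by positivity)
  norm_num at h2
  have h3 := mul_nonneg hd0 (sub_nonneg.2 h1)
  ring_nf at h2 h3 hq1 hq2
  linarith

theorem degree_le_of_inter_le_three (hM : ∀ v : V → ℝ, 0 ≤ gapForm G v v + (∑ x, v x) ^ 2)
    {A : Finset V} (hA : ∀ a ∈ A, ∀ b ∈ A, ¬ G.Adj a b) (hA39 : A.card = 39)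
    (h3 : ∀ x ∉ A, (G.neighborFinset x ∩ A).card ≤ 3) (x : V) :
    G.degree x ≤ 14 := by
  by_cases hx : x ∈ A
  · exact degree_le_of_mem hM hA hA39 (fun x hx => (h3 x hx).trans (by norm_num)) hx
  obtain ⟨Q, hQ0, hQ, h⟩ := schur_star hM hA (Finset.card_pos.1 (by omega)) hx
    (Y := G.neighborFinset x \ A) Finset.sdiff_subset Finset.sdiff_disjoint (c := 3)
    (fun y hy => h3 y (Finset.mem_sdiff.1 hy).2)
  have hp := h3 x hx
  rw [degree_eq_inter_add_sdiff A x]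
  rw [hA39] at h
  generalize (G.neighborFinset x ∩ A).card = p at *
  generalize (G.neighborFinset x \ A).card = d at *
  have hd0 : (0 : ℝ) ≤ d := by positivity
  have hq1 : 0 ≤ (3 * d - Q) * d := mul_nonneg (by push_cast at hQ; linarith) hd0
  have hq2 : 0 ≤ (3 * d - Q) ^ 2 := sq_nonneg _
  have key : d ≤ 11 := by
    by_contra hcon
    have h1 : (12 : ℝ) ≤ d := by exact_mod_cast not_le.1 hcon
    -- One compromise value of α serves all p ≤ 3; the degree is then at most 3 + 11.
    have h2 := h (0.5 * d) (by positivity)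
    have h3 := mul_nonneg hd0 (sub_nonneg.2 h1)
    interval_cases p <;> norm_num at h2 <;> ring_nf at h2 h3 hq1 hq2 <;> linarith
  omega

end Degrees

/-! ### A large set on which the form is definite -/

section Definite

variable {V : Type*} [Fintype V] [DecidableEq V] {G : SimpleGraph V} [DecidableRel G.Adj]

variable (G) in
/-- The vertices outside `X` with a neighbour in `X`. -/
def outerBoundary (X : Finset V) : Finset V := {z | z ∉ X ∧ ∃ x ∈ X, G.Adj z x}

theorem mem_outerBoundary {X : Finset V} {z : V} :
    z ∈ outerBoundary G X ↔ z ∉ X ∧ ∃ x ∈ X, G.Adj z x := by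
  simp [outerBoundary]

/-- K pays for the discarded part of D and its outer boundary, Δ for the neighbours of one outer
neighbour z. If D has no outer neighbour, the negative vector y takes over the role of z. -/
theorem exists_posDefOn_of_bad_set (hM : ∀ v : V → ℝ, 0 ≤ gapForm G v v + (∑ x, v x) ^ 2)
    {D T : Finset V} {u : V → ℝ} (hD : D.Nonempty) (hu : ∀ x ∈ D, 0 < u x)
    (hu' : ∀ x ∉ D, u x = 0) (huu : gapForm G u u ≤ 0) (hTD : T ⊆ D) (hT : PosDefOn G T)
    {y : V → ℝ} (hy : gapForm G y y < 0) {K Δ : ℕ}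
    (hK : (D \ T ∪ outerBoundary G D).card ≤ K) (hΔ : ∀ z, G.degree z ≤ Δ) :
    ∃ U : Finset V, PosDefOn G U ∧ Uᶜ.card ≤ K + Δ := by
  rcases (outerBoundary G D).eq_empty_or_nonempty with h0 | ⟨z, hz⟩
  · refine ⟨(D \ T)ᶜ, ?_, ?_⟩
    · obtain ⟨d, hd⟩ := hD
      refine posDefOn_of_isolated hM (u := u) (D := D) (T := T) (fun x => ?_) ?_ hu' huu hTD hT
        (fun x hx z hz hxz => ?_) (fun x hx hxT hxD => ?_) hy
      · by_cases hx : x ∈ D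
        · exact (hu x hx).le
        · simp [hu' x hx]
      · intro h
        have := hu d hd
        simp [h] at this
      · have : z ∈ outerBoundary G D := mem_outerBoundary.2 ⟨hz, x, hx, hxz.symm⟩
        simp [h0] at this
      · simp [hxT, hxD] at hx
    · rw [compl_compl]
      exact ((Finset.card_le_card Finset.subset_union_left).trans hK).trans (Nat.le_add_right _ _)
  · refine ⟨(D \ T ∪ outerBoundary G D ∪ G.neighborFinset z)ᶜ, ?_, ?_⟩
    · obtain ⟨hzD, d, hd, hzd⟩ := mem_outerBoundary.1 hz
      refine posDefOn_of_adj hM hu hu' huu hTD hT hzD hd hzd (fun x hx hxT => ?_) fun x hx => ?_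
      · simp only [Finset.mem_compl, Finset.mem_union, Finset.mem_sdiff, mem_outerBoundary] at hx
        push Not at hx
        have hxD : x ∉ D := fun h => hxT (hx.1.1 h)
        exact ⟨hxD, hx.1.2 hxD⟩
      · simp only [Finset.mem_compl, Finset.mem_union, SimpleGraph.mem_neighborFinset] at hx
        push Not at hx
        exact hx.2
    · rw [compl_compl]
      refine (Finset.card_union_le _ _).trans (Nat.add_le_add hK ?_)
      rw [SimpleGraph.card_neighborFinset_eq_degree]
      exact hΔ z

theorem gapForm_indVec_single_le {X : Finset V} {z : V}
    (hz : z ∈ outerBoundary G X) : gapForm G (Pi.single z 1) (indVec X) ≤ -2 := by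
  obtain ⟨h1, x, hx, hzx⟩ := mem_outerBoundary.1 hz
  rw [gapForm_single_left]
  have h2 : (1 : ℝ) ≤ ∑ y ∈ G.neighborFinset z, indVec X y := by
    have h3 : indVec X x = 1 := by simp [indVec, hx]
    rw [← h3]
    exact Finset.single_le_sum (f := indVec X)
      (fun i _ => by unfold indVec; split_ifs <;> norm_num) (by simpa using hzx)
  have h4 : indVec X z = 0 := by simp [indVec, h1]
  rw [h4]; linarith

/-- A connected set with four outer neighbours spans, with these, a set on which the form
is not definite. -/
theorem card_outerBoundary_le_three {X : Finset V} (hX : gapForm G (indVec X) (indVec X) ≤ 4)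
    (h : ∀ W : Finset V, W.card ≤ X.card + 4 → PosDefOn G W) :
    (outerBoundary G X).card ≤ 3 := by
  by_contra hcon
  obtain ⟨E, hE, hE4⟩ := Finset.exists_subset_card_eq (not_le.1 hcon : 4 ≤ _)
  have hpd := h (X ∪ E) ((Finset.card_union_le _ _).trans (by omega))
  -- With weight 2 on X and 1 on four outer neighbours, the form is at most 16 − 32 + 16 = 0.
  have hpos := hpd ((2 : ℝ) • indVec X + indVec E) (fun x hx => by
    simp only [Finset.mem_union, not_or] at hx
    simp [indVec, hx.1, hx.2]) (by
    obtain ⟨z, hz⟩ := Finset.card_pos.1 (by omega : 0 < E.card)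
    intro h0
    have h1 := congrFun h0 z
    have h2 : z ∉ X := (mem_outerBoundary.1 (hE hz)).1
    simp [indVec, h2, hz] at h1)
  have hEX : gapForm G (indVec E) (indVec X) ≤ -8 := by
    rw [gapForm_indVec_left]
    calc _ ≤ ∑ z ∈ E, (-2 : ℝ) := Finset.sum_le_sum fun z hz => by
          rw [← gapForm_single_left]; exact gapForm_indVec_single_le (hE hz)
      _ = -8 := by simp [hE4]; norm_num
  have hEE := gapForm_indVec_self_le (G := G) E
  rw [hE4] at hEE
  rw [gapForm_add_self, gapForm_smul_left, gapForm_smul_left, gapForm_smul_right,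
    gapForm_comm (indVec X) (indVec E)] at hpos
  push_cast at hEE
  linarith

theorem indVec_singleton (x : V) : indVec {x} = Pi.single x (1 : ℝ) := by
  ext y; simp [indVec, Pi.single_apply]

theorem indVec_insert {X : Finset V} {z : V} (hz : z ∉ X) :
    indVec (insert z X) = Pi.single z 1 + indVec X := by
  ext y
  by_cases h : y = z
  · subst h; simp [indVec, hz]
  · simp [indVec, h]

/-- A minimal set on which the form is not definite contains connected sets of all
sizes. -/
theorem exists_subset_gapForm_indVec_le {D : Finset V} (hD : ¬ PosDefOn G D)
    (hmin : ∀ W : Finset V, W.card < D.card → PosDefOn G W) {k : ℕ} (hk : 1 ≤ k)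
    (hkD : k ≤ D.card) :
    ∃ X ⊆ D, X.card = k ∧ gapForm G (indVec X) (indVec X) ≤ 4 := by
  induction k, hk using Nat.le_induction with
  | base =>
    obtain ⟨x, hx⟩ := Finset.card_pos.1 hkD
    refine ⟨{x}, by simpa using hx, by simp, ?_⟩
    rw [indVec_singleton, gapForm_single_self]
  | succ k hk ih =>
    obtain ⟨X, hXD, hXk, hX⟩ := ih (by omega)
    -- Adding a neighbour changes the form by at most 4 − 2·2 = 0. With no neighbour left in D, the
    -- witness for D splits over two smaller, hence definite, pieces.
    by_cases hadj : ∃ z ∈ D, z ∈ outerBoundary G X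
    · obtain ⟨z, hzD, hz⟩ := hadj
      have hzX := (mem_outerBoundary.1 hz).1
      refine ⟨insert z X, Finset.insert_subset hzD hXD, by simp [hzX, hXk], ?_⟩
      rw [indVec_insert hzX, gapForm_add_self, gapForm_single_self]
      have := gapForm_indVec_single_le hz
      linarith
    · exfalso
      push Not at hadj
      obtain ⟨v, hv, hv0, hvD, hvv⟩ := exists_nonneg_of_not_posDefOn hD
      rw [gapForm_restrict_add v X (fun x hx y hy hxy => Or.inr (by
        by_contra h
        exact hadj y (by_contra fun hyD => h (hvD y hyD))
          (mem_outerBoundary.2 ⟨hy, x, hx, hxy.symm⟩)))] at hvv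
      have h1 : PosDefOn G X := hmin X (by omega)
      have h2 : PosDefOn G (D \ X) := hmin _ (by rw [Finset.card_sdiff_of_subset hXD]; omega)
      have hs1 : ∀ x ∉ X, (fun x => if x ∈ X then v x else 0) x = 0 := fun x hx => by simp [hx]
      have hs2 : ∀ x ∉ D \ X, (fun x => if x ∈ X then 0 else v x) x = 0 := fun x hx => by
        by_cases hxX : x ∈ X
        · simp [hxX]
        · simp only [Finset.mem_sdiff, hxX, not_false_eq_true, and_true] at hx
          simp [hxX, hvD x hx]
      have hz : ∀ w : V → ℝ, w = 0 → gapForm G w w = 0 := by rintro w rfl; simp [gapForm]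
      by_cases e1 : (fun x => if x ∈ X then v x else 0) = 0
      · by_cases e2 : (fun x => if x ∈ X then 0 else v x) = 0
        · apply hv0
          ext x
          have f1 := congrFun e1 x
          have f2 := congrFun e2 x
          by_cases hxX : x ∈ X
          · simpa [hxX] using f1
          · simpa [hxX] using f2
        · have := h2 _ hs2 e2
          rw [hz _ e1] at hvv
          linarith
      · have p1 := h1 _ hs1 e1
        by_cases e2 : (fun x => if x ∈ X then 0 else v x) = 0
        · rw [hz _ e2] at hvv
          linarith
        · have := h2 _ hs2 e2
          linarith

theorem posDefOn_empty : PosDefOn G ∅ := fun _ hv hv0 =>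
  absurd (funext fun x => hv x (Finset.notMem_empty x)) hv0

/-- A minimal non-definite set carries a strictly positive vector of nonpositive form. -/
theorem exists_pos_of_minimal {D : Finset V} (hD : ¬ PosDefOn G D)
    (hmin : ∀ W : Finset V, W.card < D.card → PosDefOn G W) :
    ∃ u : V → ℝ, (∀ x ∈ D, 0 < u x) ∧ (∀ x ∉ D, u x = 0) ∧ gapForm G u u ≤ 0 := by
  obtain ⟨v, hv, hv0, hvD, hvv⟩ := exists_nonneg_of_not_posDefOn hD
  refine ⟨v, fun x hx => lt_of_le_of_ne (hv x) fun h => ?_, hvD, hvv⟩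
  have := hmin (D.erase x) (Finset.card_erase_lt_of_mem hx) v (fun y hy => ?_) hv0
  · linarith
  · by_cases hyx : y = x
    · rw [hyx]; exact h.symm
    · exact hvD y fun h => hy (Finset.mem_erase.2 ⟨hyx, h⟩)

theorem exists_minimal_not_posDefOn {y : V → ℝ} (hy : gapForm G y y < 0) :
    ∃ D : Finset V, ¬ PosDefOn G D ∧ ∀ W : Finset V, W.card < D.card → PosDefOn G W := by
  classical
  have huniv : ¬ PosDefOn G univ := fun h =>
    absurd (h y (by simp) (by rintro rfl; simp [gapForm] at hy)) hy.le.not_gt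
  obtain ⟨D, hD, hmin⟩ := Finset.exists_min_image
    ((univ : Finset (Finset V)).filter fun W => ¬ PosDefOn G W) Finset.card ⟨univ, by simp [huniv]⟩
  refine ⟨D, by simpa using hD, fun W hW => ?_⟩
  by_contra h
  exact absurd (hmin W (by simp [h])) hW.not_ge

/-- A minimal non-definite D with at most five vertices is deleted whole with its boundary, at most
5·15 vertices. A larger one forces degrees at most 3 and a small boundary, and only one of its
vertices is deleted. -/
theorem exists_posDefOn_of_degree_le (hM : ∀ v : V → ℝ, 0 ≤ gapForm G v v + (∑ x, v x) ^ 2)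
    (hdeg : ∀ x, G.degree x ≤ 14) {y : V → ℝ} (hy : gapForm G y y < 0) :
    ∃ U : Finset V, PosDefOn G U ∧ Uᶜ.card ≤ 91 := by
  obtain ⟨D, hD, hmin⟩ := exists_minimal_not_posDefOn hy
  obtain ⟨u, hu, hu', huu⟩ := exists_pos_of_minimal hD hmin
  have hDne : D.Nonempty := by
    rw [Finset.nonempty_iff_ne_empty]
    rintro rfl
    exact hD posDefOn_empty
  rcases le_or_gt D.card 5 with h5 | h6
  · have hK : (D \ ∅ ∪ outerBoundary G D).card ≤ 75 := by
      have hsub : D \ ∅ ∪ outerBoundary G D ⊆ D.biUnion fun d => insert d (G.neighborFinset d) := by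
        intro z hz
        simp only [Finset.sdiff_empty, Finset.mem_union, mem_outerBoundary] at hz
        rw [Finset.mem_biUnion]
        rcases hz with hz | ⟨-, d, hd, hzd⟩
        · exact ⟨z, hz, by simp⟩
        · exact ⟨d, hd, by simp [hzd.symm]⟩
      have h1 := (Finset.card_le_card hsub).trans
        (Finset.card_biUnion_le_card_mul D _ 15 fun d _ => (Finset.card_insert_le _ _).trans (by
          rw [SimpleGraph.card_neighborFinset_eq_degree]; have := hdeg d; omega))
      omega
    obtain ⟨U, hU, hUc⟩ := exists_posDefOn_of_bad_set hM hDne hu hu' huu (Finset.empty_subset D)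
      posDefOn_empty hy hK hdeg
    exact ⟨U, hU, by omega⟩
  · have hdeg3 : ∀ x, G.degree x ≤ 3 := by
      intro x
      have h1 := card_outerBoundary_le_three (G := G) (X := {x})
        (by rw [indVec_singleton, gapForm_single_self])
        (fun W hW => hmin W (by rw [Finset.card_singleton] at hW; omega))
      rw [← SimpleGraph.card_neighborFinset_eq_degree]
      refine (Finset.card_le_card fun z hz => ?_).trans h1
      rw [SimpleGraph.mem_neighborFinset] at hz
      exact mem_outerBoundary.2 ⟨by simpa using hz.ne', x, by simp, hz.symm⟩
    -- Five vertices are left out so that X with four outer neighbours still has fewer vertices than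
    -- D.
    obtain ⟨X, hXD, hXc, hX⟩ := exists_subset_gapForm_indVec_le hD hmin
      (by omega : 1 ≤ D.card - 5) (by omega)
    have hX3 := card_outerBoundary_le_three hX (fun W hW => hmin W (by omega))
    have hE : (outerBoundary G D).card ≤ 18 := by
      have hsub : outerBoundary G D ⊆
          outerBoundary G X ∪ (D \ X).biUnion fun d => G.neighborFinset d := by
        intro z hz
        obtain ⟨hzD, d, hd, hzd⟩ := mem_outerBoundary.1 hz
        rw [Finset.mem_union, Finset.mem_biUnion]
        by_cases hdX : d ∈ X
        · exact Or.inl (mem_outerBoundary.2 ⟨fun h => hzD (hXD h), d, hdX, hzd⟩)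
        · exact Or.inr ⟨d, by simp [hd, hdX], by simp [hzd.symm]⟩
      have h1 := Finset.card_biUnion_le_card_mul (D \ X) (fun d => G.neighborFinset d) 3
        fun d _ => by rw [SimpleGraph.card_neighborFinset_eq_degree]; exact hdeg3 d
      have h2 := (Finset.card_le_card hsub).trans (Finset.card_union_le _ _)
      rw [Finset.card_sdiff_of_subset hXD] at h1
      omega
    obtain ⟨d, hd⟩ := id hDne
    have hK : (D \ D.erase d ∪ outerBoundary G D).card ≤ 19 := by
      have h1 := Finset.card_union_le (D \ D.erase d) (outerBoundary G D)
      rw [Finset.sdiff_erase_self hd, Finset.card_singleton] at h1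
      rw [Finset.sdiff_erase_self hd]
      omega
    obtain ⟨U, hU, hUc⟩ := exists_posDefOn_of_bad_set hM hDne hu hu' huu (Finset.erase_subset d D)
      (hmin _ (Finset.card_erase_lt_of_mem hd)) hy hK hdeg3
    exact ⟨U, hU, by omega⟩

/-- A vertex with four neighbours in A centres a star that serves as D; it and its boundary cost at
most 1 + 9 + 4·14 = 66. Otherwise all degrees are at most 14. -/
theorem exists_posDefOn (hM : ∀ v : V → ℝ, 0 ≤ gapForm G v v + (∑ x, v x) ^ 2)
    {A : Finset V} (hA : ∀ a ∈ A, ∀ b ∈ A, ¬ G.Adj a b) (hA39 : A.card = 39)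
    (h5 : ∀ x ∉ A, (G.neighborFinset x ∩ A).card ≤ 5) {y : V → ℝ} (hy : gapForm G y y < 0) :
    ∃ U : Finset V, PosDefOn G U ∧ Uᶜ.card ≤ 91 := by
  by_cases h4 : ∃ x ∉ A, 4 ≤ (G.neighborFinset x ∩ A).card
  · obtain ⟨x, hxA, hx4⟩ := h4
    obtain ⟨L, hL, hL4⟩ := Finset.exists_subset_card_eq hx4
    have hLA : L ⊆ A := hL.trans Finset.inter_subset_right
    have hLN : L ⊆ G.neighborFinset x := hL.trans Finset.inter_subset_left
    have hxL : x ∉ L := fun h => hxA (hLA h)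
    have hdeg : ∀ z, G.degree z ≤ 21 := by
      intro z
      by_cases hz : z ∈ A
      · exact (degree_le_of_mem hM hA hA39 h5 hz).trans (by norm_num)
      · exact (degree_le_of_notMem hM hA hA39 h5 hz).1
    -- This is the null vector of the affine diagram D̃₄: weight 2 at the centre, 1 at the four
    -- leaves.
    have huu : gapForm G ((2 : ℝ) • Pi.single x 1 + indVec L) ((2 : ℝ) • Pi.single x 1 + indVec L)
        ≤ 0 := by
      have h1 := gapForm_indVec_self_le (G := G) L
      have h2 : ∑ y ∈ G.neighborFinset x, indVec L y = 4 := by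
        simp [indVec, Finset.sum_ite_mem, Finset.inter_eq_right.2 hLN, hL4]
      have h3 : indVec L x = 0 := by simp [indVec, hxL]
      rw [gapForm_add_self, gapForm_smul_left, gapForm_smul_left, gapForm_smul_right,
        gapForm_single_self, gapForm_single_left, h2, h3]
      rw [hL4] at h1
      push_cast at h1
      linarith
    have hK : (insert x L \ ∅ ∪ outerBoundary G (insert x L)).card ≤ 66 := by
      have hsub : insert x L \ ∅ ∪ outerBoundary G (insert x L) ⊆
          insert x (G.neighborFinset x) ∪ L.biUnion fun a => G.neighborFinset a := by
        intro z hz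
        simp only [Finset.sdiff_empty, Finset.mem_union, mem_outerBoundary, Finset.mem_insert] at hz
        simp only [Finset.mem_union, Finset.mem_insert, Finset.mem_biUnion]
        rcases hz with (hz | hz) | ⟨-, d, hd | hd, hzd⟩
        · exact Or.inl (Or.inl hz)
        · exact Or.inl (Or.inr (hLN hz))
        · subst hd
          exact Or.inl (Or.inr (by simpa using hzd.symm))
        · exact Or.inr ⟨d, hd, by simpa using hzd.symm⟩
      have h1 := Finset.card_biUnion_le_card_mul L (fun a => G.neighborFinset a) 14
        fun a ha => by
          rw [SimpleGraph.card_neighborFinset_eq_degree]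
          exact degree_le_of_mem hM hA hA39 h5 (hLA ha)
      have h2 := (Finset.card_le_card hsub).trans (Finset.card_union_le _ _)
      have h3 := Finset.card_insert_le x (G.neighborFinset x)
      rw [SimpleGraph.card_neighborFinset_eq_degree] at h3
      have h4 := (degree_le_of_notMem hM hA hA39 h5 hxA).2 hx4
      omega
    obtain ⟨U, hU, hUc⟩ := exists_posDefOn_of_bad_set hM (D := insert x L)
      (u := (2 : ℝ) • Pi.single x 1 + indVec L) (Finset.insert_nonempty x L)
      (fun z hz => by
        rcases Finset.mem_insert.1 hz with rfl | hzL
        · simp [indVec, hxL]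
        · have : z ≠ x := by rintro rfl; exact hxL hzL
          simp [indVec, hzL, this])
      (fun z hz => by
        simp only [Finset.mem_insert, not_or] at hz
        simp [indVec, hz.1, hz.2])
      huu (Finset.empty_subset _) posDefOn_empty hy hK hdeg
    exact ⟨U, hU, by omega⟩
  · push Not at h4
    exact exists_posDefOn_of_degree_le hM
      (degree_le_of_inter_le_three hM hA hA39 fun x hx => Nat.le_of_lt_succ (h4 x hx)) hy

theorem rank_bound_of_independent (hn : 277 ≤ Fintype.card V)
    (hM : ∀ v : V → ℝ, 0 ≤ gapForm G v v + (∑ x, v x) ^ 2)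
    {A : Finset V} (hA : ∀ a ∈ A, ∀ b ∈ A, ¬ G.Adj a b) (hA39 : A.card = 39)
    (h5 : ∀ x ∉ A, (G.neighborFinset x ∩ A).card ≤ 5) :
    2 * (Fintype.card V : ℝ) + 3 ≤ 3 * (gapMatrix G + of fun _ _ => (1 : ℝ)).rank := by
  by_cases h : ∀ v : V → ℝ, 0 ≤ gapForm G v v
  · exact rank_bound_of_posSemidef (by omega) h
  · push Not at h
    obtain ⟨y, hy⟩ := h
    obtain ⟨U, hU, hUc⟩ := exists_posDefOn hM hA hA39 h5 hy
    have h1 := card_le_rank_of_posDefOn hU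
    rw [Finset.card_compl] at hUc
    -- The inequality 2n + 3 ≤ 3(n − 91) needs n ≥ 276.
    have h2 : 2 * Fintype.card V + 3 ≤ 3 * (gapMatrix G + of fun _ _ => (1 : ℝ)).rank := by omega
    exact_mod_cast h2

end Definite

/-! ### Switching and the reduction to graphs -/

section Switching

variable {V : Type*} [Fintype V] [DecidableEq V]

/-- The matrix obtained from `S` by switching with respect to the signs `ε`. -/
def switchMatrix (ε : V → ℝ) (S : Matrix V V ℝ) : Matrix V V ℝ :=
  diagonal ε * S * diagonal ε

theorem switchMatrix_apply (ε : V → ℝ) (S : Matrix V V ℝ) (i j : V) :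
    switchMatrix ε S i j = ε i * S i j * ε j := by
  simp [switchMatrix]

theorem IsSeidelMatrix.switch {S : Matrix V V ℝ} (hS : IsSeidelMatrix S) {ε : V → ℝ}
    (hε : ∀ i, ε i = 1 ∨ ε i = -1) : IsSeidelMatrix (switchMatrix ε S) := by
  obtain ⟨h1, h2, h3⟩ := hS
  refine ⟨?_, fun i => by simp [switchMatrix_apply, h2], fun i j hij => ?_⟩
  · ext i j
    rw [transpose_apply, switchMatrix_apply, switchMatrix_apply, h1.apply i j]; ring
  · rw [switchMatrix_apply]
    rcases hε i with h | h <;> rcases hε j with h' | h' <;> rcases h3 i j hij with h'' | h'' <;>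
      simp [h, h', h'']

theorem seidelGraph_adj {S : Matrix V V ℝ} (hS : IsSeidelMatrix S) {i j : V} :
    (seidelGraph S).Adj i j ↔ S i j = -1 := by
  simp only [seidelGraph, SimpleGraph.fromRel_adj, hS.1.apply i j, or_self]
  refine ⟨fun h => h.2, fun h => ⟨?_, h⟩⟩
  rintro rfl
  have := hS.2.1 i
  linarith

theorem seidel_add_five_eq {S : Matrix V V ℝ} (hS : IsSeidelMatrix S)
    [DecidableRel (seidelGraph S).Adj] :
    S + (5 : ℝ) • 1 = gapMatrix (seidelGraph S) + of fun _ _ => (1 : ℝ) := by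
  ext i j
  simp only [gapMatrix, Matrix.add_apply, Matrix.smul_apply, Matrix.sub_apply, of_apply,
    SimpleGraph.adjMatrix_apply, seidelGraph_adj hS, smul_eq_mul]
  by_cases hij : i = j
  · subst hij
    simp [hS.2.1]; norm_num
  · rcases hS.2.2 i j hij with h | h
    · rw [h]; norm_num [hij]
    · rw [h]; norm_num [hij]

theorem diagonal_sign_mul_self {ε : V → ℝ} (hε : ∀ i, ε i = 1 ∨ ε i = -1) :
    diagonal ε * diagonal ε = (1 : Matrix V V ℝ) := by
  rw [diagonal_mul_diagonal, ← diagonal_one]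
  congr 1
  ext i
  rcases hε i with h | h <;> simp [h]

theorem switchMatrix_add_five {ε : V → ℝ} (hε : ∀ i, ε i = 1 ∨ ε i = -1) (S : Matrix V V ℝ) :
    switchMatrix ε S + (5 : ℝ) • 1 = diagonal ε * (S + (5 : ℝ) • 1) * diagonal ε := by
  rw [switchMatrix, Matrix.mul_add, Matrix.add_mul, Matrix.mul_smul, Matrix.smul_mul,
    Matrix.mul_one, diagonal_sign_mul_self hε]

theorem rank_switchMatrix_add_five {ε : V → ℝ} (hε : ∀ i, ε i = 1 ∨ ε i = -1)
    (S : Matrix V V ℝ) :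
    (switchMatrix ε S + (5 : ℝ) • 1).rank = (S + (5 : ℝ) • 1).rank := by
  have hu : IsUnit (diagonal ε : Matrix V V ℝ).det :=
    (Matrix.isUnit_iff_isUnit_det _).1 (IsUnit.of_mul_eq_one _ (diagonal_sign_mul_self hε))
  rw [switchMatrix_add_five hε, rank_mul_eq_left_of_isUnit_det _ _ hu,
    rank_mul_eq_right_of_isUnit_det _ _ hu]

theorem add_five_form_nonneg {S : Matrix V V ℝ} (hS : IsSeidelMatrix S)
    (hmin : IsSmallestEigenvalue S (-5)) (v : V → ℝ) : 0 ≤ v ⬝ᵥ ((S + (5 : ℝ) • 1) *ᵥ v) := by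
  have hH : (S + (5 : ℝ) • (1 : Matrix V V ℝ)).IsHermitian := by
    rw [IsHermitian, conjTranspose_eq_transpose_of_trivial, transpose_add, transpose_smul,
      transpose_one, hS.1]
  have hpsd : (S + (5 : ℝ) • (1 : Matrix V V ℝ)).PosSemidef := by
    rw [hH.posSemidef_iff_eigenvalues_nonneg]
    intro i
    have h1 := hH.mulVec_eigenvectorBasis i
    have h2 : Module.End.HasEigenvalue (Matrix.toLin' S) (hH.eigenvalues i - 5) := by
      refine Module.End.hasEigenvalue_of_hasEigenvector
        (x := (WithLp.ofLp (hH.eigenvectorBasis i) : V → ℝ)) ⟨?_, ?_⟩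
      · rw [Module.End.mem_eigenspace_iff, Matrix.toLin'_apply, sub_smul, ← h1, add_mulVec,
          smul_mulVec, one_mulVec]
        simp
      · intro h
        exact hH.eigenvectorBasis.orthonormal.ne_zero i (by ext j; exact congrFun h j)
    have h3 := hmin.2 h2
    simp only [Pi.zero_apply]
    linarith
  simpa using hpsd.dotProduct_mulVec_nonneg v

theorem switch_form_nonneg {S : Matrix V V ℝ} (hS : IsSeidelMatrix S)
    (hmin : IsSmallestEigenvalue S (-5)) {ε : V → ℝ} (hε : ∀ i, ε i = 1 ∨ ε i = -1)
    [DecidableRel (seidelGraph (switchMatrix ε S)).Adj] (v : V → ℝ) :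
    0 ≤ gapForm (seidelGraph (switchMatrix ε S)) v v + (∑ x, v x) ^ 2 := by
  have h1 := add_five_form_nonneg hS hmin (diagonal ε *ᵥ v)
  have h2 : (diagonal ε *ᵥ v) ⬝ᵥ ((S + (5 : ℝ) • 1) *ᵥ (diagonal ε *ᵥ v)) =
      v ⬝ᵥ ((switchMatrix ε S + (5 : ℝ) • 1) *ᵥ v) := by
    rw [switchMatrix_add_five hε, ← mulVec_mulVec, ← mulVec_mulVec]
    conv_rhs => rw [dotProduct_mulVec, ← mulVec_transpose, diagonal_transpose]
  rw [h2, seidel_add_five_eq (hS.switch hε), dotProduct_add_ones_mulVec, ← sq] at h1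
  exact h1

/-- An independent set of the switching graph with at least three vertices comes from a set of
indices on which some switching has all entries `1`. -/
theorem exists_sign_of_isIndepSet {S : Matrix V V ℝ} (hS : IsSeidelMatrix S) {I : Finset (V ⊕ V)}
    (hI : (switchingGraph S).IsIndepSet I) (h3 : 3 ≤ I.card) :
    ∃ (B : Finset V) (ε : V → ℝ), B.card = I.card ∧ (∀ i, ε i = 1 ∨ ε i = -1) ∧
      ∀ i ∈ B, ∀ j ∈ B, i ≠ j → ε i * S i j * ε j = 1 := by
  classical
  have hnadj : ∀ a ∈ I, ∀ b ∈ I, a ≠ b →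
      fromBlocks S (-S + 1) (-S + 1) S a b ≠ -1 := by
    intro a ha b hb hab h
    exact hI ha hb hab (by
      simp only [switchingGraph, seidelGraph, SimpleGraph.fromRel_adj]
      exact ⟨hab, Or.inl h⟩)
  have hll : ∀ i j, i ≠ j → Sum.inl i ∈ I → Sum.inl j ∈ I → S i j = 1 := by
    intro i j hij hi hj
    have := hnadj _ hi _ hj (by simpa using hij)
    rw [fromBlocks_apply₁₁] at this
    exact (hS.2.2 i j hij).resolve_right this
  have hrr : ∀ i j, i ≠ j → Sum.inr i ∈ I → Sum.inr j ∈ I → S i j = 1 := by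
    intro i j hij hi hj
    have := hnadj _ hi _ hj (by simpa using hij)
    rw [fromBlocks_apply₂₂] at this
    exact (hS.2.2 i j hij).resolve_right this
  have hlr : ∀ i j, i ≠ j → Sum.inl i ∈ I → Sum.inr j ∈ I → S i j = -1 := by
    intro i j hij hi hj
    have := hnadj _ hi _ hj (by simp)
    rw [fromBlocks_apply₁₂] at this
    refine (hS.2.2 i j hij).resolve_left fun h => this ?_
    simp [h, hij]
  -- Both copies of i cannot occur: a third element of I would force opposite signs for the same
  -- entry of S.
  have hboth : ∀ i, Sum.inl i ∈ I → Sum.inr i ∉ I := by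
    intro i hi hi'
    have hc : ((I.erase (Sum.inl i)).erase (Sum.inr i)).Nonempty := by
      rw [← Finset.card_pos, Finset.card_erase_of_mem (by simp [hi']), Finset.card_erase_of_mem hi]
      omega
    obtain ⟨k, hk⟩ := hc
    rw [Finset.mem_erase, Finset.mem_erase] at hk
    rcases k with k | k
    · have hki : k ≠ i := fun h => hk.2.1 (by rw [h])
      have e1 := hll k i hki hk.2.2 hi
      have e2 := hlr k i hki hk.2.2 hi'
      linarith
    · have hki : k ≠ i := fun h => hk.1 (by rw [h])
      have e1 := hrr k i hki hk.2.2 hi'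
      have e2 := hlr i k hki.symm hi hk.2.2
      rw [hS.1.apply k i] at e2
      linarith
  refine ⟨I.image (Sum.elim id id), fun i => if Sum.inl i ∈ I then 1 else -1, ?_, fun i => ?_, ?_⟩
  · refine Finset.card_image_of_injOn ?_
    rintro (a | a) ha (b | b) hb hab <;> simp only [Sum.elim_inl, Sum.elim_inr, id] at hab <;>
      subst hab
    · rfl
    · exact absurd hb (hboth _ ha)
    · exact absurd ha (hboth _ hb)
    · rfl
  · dsimp only; split_ifs <;> simp
  · have hmem : ∀ i ∈ I.image (Sum.elim id id), Sum.inl i ∉ I → Sum.inr i ∈ I := by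
      intro i hi h
      obtain ⟨a, ha, rfl⟩ := Finset.mem_image.1 hi
      rcases a with a | a
      · exact absurd ha h
      · exact ha
    intro i hi j hj hij
    by_cases h1 : Sum.inl i ∈ I <;> by_cases h2 : Sum.inl j ∈ I
    · simp [h1, h2, hll i j hij h1 h2]
    · simp [h1, h2, hlr i j hij h1 (hmem j hj h2)]
    · have := hlr j i hij.symm h2 (hmem i hi h1)
      rw [hS.1.apply i j] at this
      simp [h1, h2, this]
    · simp [h1, h2, hrr i j hij (hmem i hi h1) (hmem j hj h2)]

open Classical in
/-- Some switching has an independent set of order 39 in which all other vertices have at most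
five neighbours. -/
theorem exists_good_switching {S : Matrix V V ℝ} (hS : IsSeidelMatrix S)
    (hmin : IsSmallestEigenvalue S (-5)) (hα : 39 ≤ switchingIndepNum S) :
    ∃ (A : Finset V) (ε : V → ℝ), A.card = 39 ∧ (∀ i, ε i = 1 ∨ ε i = -1) ∧
      (∀ a ∈ A, ∀ b ∈ A, ¬ (seidelGraph (switchMatrix ε S)).Adj a b) ∧
      ∀ x ∉ A, (A.filter fun a => (seidelGraph (switchMatrix ε S)).Adj x a).card ≤ 5 := by
  classical
  obtain ⟨I, hI⟩ := (switchingGraph S).exists_isNIndepSet_indepNum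
  have hIc : 39 ≤ I.card := by rw [hI.card_eq]; exact hα
  obtain ⟨B, ε, hBc, hε, hB⟩ := exists_sign_of_isIndepSet hS hI.isIndepSet (by omega)
  obtain ⟨A, hAB, hA39⟩ := Finset.exists_subset_card_eq (hBc ▸ hIc : 39 ≤ B.card)
  have hAind : ∀ η : V → ℝ, (∀ i, η i = 1 ∨ η i = -1) → (∀ a ∈ A, η a = ε a) →
      ∀ a ∈ A, ∀ b ∈ A, ¬ (seidelGraph (switchMatrix η S)).Adj a b := by
    intro η hη hηε a ha b hb hab
    have hne := hab.ne
    rw [seidelGraph_adj (hS.switch hη), switchMatrix_apply, hηε a ha, hηε b hb,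
      hB a (hAB ha) b (hAB hb) hne] at hab
    norm_num at hab
  have hcount : ∀ x ∉ A,
      (A.filter fun a => (seidelGraph (switchMatrix ε S)).Adj x a).card ≤ 5 ∨
      34 ≤ (A.filter fun a => (seidelGraph (switchMatrix ε S)).Adj x a).card := by
    intro x hx
    have := card_neighbor_inter (switch_form_nonneg hS hmin hε) (hAind ε hε fun _ _ => rfl) hA39 hx
    have he : (seidelGraph (switchMatrix ε S)).neighborFinset x ∩ A =
        A.filter fun a => (seidelGraph (switchMatrix ε S)).Adj x a := by
      ext; simp [and_comm]
    rwa [he] at this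
  -- Flipping the sign at x replaces its p neighbours in A by 39 − p, turning p ≥ 34 into at most 5;
  -- signs on A are untouched.
  let η : V → ℝ := fun x => if x ∈ A then ε x else
    if (A.filter fun a => (seidelGraph (switchMatrix ε S)).Adj x a).card ≤ 5 then ε x else -ε x
  have hη : ∀ i, η i = 1 ∨ η i = -1 := by
    intro i
    simp only [η]
    rcases hε i with h | h <;> split_ifs <;> simp [h]
  have hηA : ∀ a ∈ A, η a = ε a := fun a ha => by simp [η, ha]
  refine ⟨A, η, hA39, hη, hAind η hη hηA, fun x hx => ?_⟩
  have hne : ∀ a ∈ A, x ≠ a := fun a ha h => hx (h ▸ ha)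
  by_cases h5 : (A.filter fun a => (seidelGraph (switchMatrix ε S)).Adj x a).card ≤ 5
  · have hηx : η x = ε x := by simp only [η, hx, h5, if_true, if_false]
    refine le_of_eq_of_le ?_ h5
    congr 1
    refine Finset.filter_congr fun a ha => ?_
    rw [seidelGraph_adj (hS.switch hη), seidelGraph_adj (hS.switch hε), switchMatrix_apply,
      switchMatrix_apply, hηx, hηA a ha]
  · have hηx : η x = -ε x := by simp only [η, hx, h5, if_false]
    have h34 := (hcount x hx).resolve_left h5
    have hfl : (A.filter fun a => (seidelGraph (switchMatrix η S)).Adj x a) =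
        A.filter fun a => ¬ (seidelGraph (switchMatrix ε S)).Adj x a := by
      refine Finset.filter_congr fun a ha => ?_
      rw [seidelGraph_adj (hS.switch hη), seidelGraph_adj (hS.switch hε)]
      have h1 := (hS.switch hε).2.2 x a (hne a ha)
      rw [switchMatrix_apply] at h1 ⊢
      rw [switchMatrix_apply, hηx, hηA a ha, neg_mul, neg_mul, neg_inj]
      constructor
      · intro h; rw [h]; norm_num
      · exact fun h => h1.resolve_right h
    rw [hfl]
    have := Finset.card_filter_add_card_filter_not (s := A)
      (fun a => (seidelGraph (switchMatrix ε S)).Adj x a)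
    omega

end Switching

theorem mainTheorem5 (n : ℕ) (hn : 277 ≤ n) (S : Matrix (Fin n) (Fin n) ℝ)
    (hS : IsSeidelMatrix S) (hmin : IsSmallestEigenvalue S (-5))
    (hclique : switchingCliqueNum S = 4) (hindep : 39 ≤ switchingIndepNum S) :
    2 * (n : ℝ) / 3 + 1 ≤ ((S + (5 : ℝ) • (1 : Matrix (Fin n) (Fin n) ℝ)).rank : ℝ) := by
  classical
  obtain ⟨A, ε, hA39, hε, hA, h5⟩ := exists_good_switching hS hmin hindep
  have h := rank_bound_of_independent (G := seidelGraph (switchMatrix ε S))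
    (by rw [Fintype.card_fin]; exact hn) (switch_form_nonneg hS hmin hε) hA hA39 (by
      intro x hx
      have he : (seidelGraph (switchMatrix ε S)).neighborFinset x ∩ A =
          A.filter fun a => (seidelGraph (switchMatrix ε S)).Adj x a := by
        ext; simp [and_comm]
      rw [he]
      convert h5 x hx)
  rw [← seidel_add_five_eq (hS.switch hε), rank_switchMatrix_add_five hε, Fintype.card_fin] at h
  linarith
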